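/- Let $\Omega=(0,1)\times(0,1)$, $T>0$, and let $\lambda,\mu$ be real constants with $\mu>0$ and $\lambda+2\mu>0$. Let $n=(n_1,n_2)$ be the outward unit normal on $\partial\Omega$, and let data $I=(\varphi,X,u_0,u_0^*,u_T)$ be given with $$\varphi\in L^1(0,T),\quad X=(X_1,X_2)\in (L^1(0,T;L^1(\partial\Omega)))^2,\quad u_0,u_0^*,u_T\in (L^1(\Omega))^2 .$$ A pair $(u,f)$ with $u=(u_1,u_2)\in \big(C^2([0,T];L^2(\Omega))\cap L^2(0,T;H^2(\Omega))\big)^2$ and $f=(f_1,f_2)\in (L^2(\Omega))^2$ is called a solution for the data $I$ if the following four conditions hold (with weak derivatives in $x$). (1) For almost every $t\in(0,T)$ and $j=1,2$, in $L^2(\Omega)$, $$\frac{\partial^2 u_j}{\partial t^2}=\mu\Delta u_j+(\lambda+\mu)\frac{\partial}{\partial x_j}\operatorname{div}(u)+\varphi(t)f_j .$$ (2) $u=0$ on $\partial\Omega$, that is, $u_j(\cdot,t)\in H^1_0(\Omega)$ for almost every $t\in(0,T)$ and $j=1,2$. (3) $u(\cdot,0)=u_0$, $\frac{\partial u}{\partial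 t}(\cdot,0)=u_0^*$ and $u(\cdot,T)=u_T$ almost everywhere in $\Omega$. (4) For almost every $t\in(0,T)$, $n_1\sigma_1+n_2\tau=X_1$ and $n_2\sigma_2+n_1\tau=X_2$ almost everywhere on $\partial\Omega$, in the sense of traces, where $\sigma_j=\lambda\operatorname{div}(u)+2\mu\frac{\partial u_j}{\partial x_j}$ and $\tau=\mu\left(\frac{\partial u_1}{\partial x_2}+\frac{\partial u_2}{\partial x_1}\right)$. **Theorem.** Suppose that $\varphi\not\equiv 0$, that is, $\varphi$ is not the zero element of $L^1(0,T)$. If $(u,f)$ and $(\tilde u,\tilde f)$ are two solutions for the same data $I$, then $u(\cdot,t)=\tilde u(\cdot,t)$ for all $t\in[0,T]$, and $f=\tilde f$. -/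

import Mathlib

open MeasureTheory Set Filter Topology
open scoped ContDiff ENNReal

namespace LameSource

noncomputable section

/-- The Euclidean plane. -/
abbrev Plane : Type := EuclideanSpace ℝ (Fin 2)

/-- The elastic body: the open unit square `(0,1) × (0,1)`. -/
def body : Set Plane := {x | ∀ i, x i ∈ Ioo (0 : ℝ) 1}

/-- The real Hilbert space `L²(Ω)`. -/
abbrev L2Body : Type := Lp ℝ 2 (volume.restrict body)

/-- `side i b` parametrizes by arc length the line `x i = b`: the `i`-th coordinate is `b`,
the other one is `s`. -/
def side (i : Fin 2) (b s : ℝ) : Plane :=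
  WithLp.toLp 2 (Function.update (fun _ => s) i b)

/-- Arc length on the boundary of the unit square: the sum of the Lebesgue measures of its four
sides `x i = b`, for `i = 0, 1` and `b = 0, 1`. -/
def arcLength : Measure Plane :=
  ∑ i : Fin 2, ((volume.restrict (Icc (0 : ℝ) 1)).map (side i 0) +
    (volume.restrict (Icc (0 : ℝ) 1)).map (side i 1))

/-- The outward unit normal on the boundary of the unit square (its value at the four corners,
a set of measure zero, plays no role). -/
def normal (x : Plane) (k : Fin 2) : ℝ :=
  if x k = 1 then 1 else if x k = 0 then -1 else 0

/-- The classical partial derivative `∂ψ/∂xᵢ`. -/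
def partialD (i : Fin 2) (ψ : Plane → ℝ) (x : Plane) : ℝ :=
  fderiv ℝ ψ x (EuclideanSpace.single i 1)

/-- Test functions: `C_c^∞(Ω)`. -/
structure IsTest (ψ : Plane → ℝ) : Prop where
  smooth : ContDiff ℝ ∞ ψ
  compact : HasCompactSupport ψ
  support : tsupport ψ ⊆ body

/-- `g` is the weak partial derivative `∂v/∂xᵢ` in `Ω`. -/
def IsWeakPartial (i : Fin 2) (v g : L2Body) : Prop :=
  ∀ ψ : Plane → ℝ, IsTest ψ →
    ∫ x in body, v x * partialD i ψ x = -∫ x in body, g x * ψ x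

open Classical in
/-- The weak partial derivative `∂v/∂xᵢ ∈ L²(Ω)` (set to `0` when `v` has none in `L²(Ω)`). -/
def weakPartial (i : Fin 2) (v : L2Body) : L2Body :=
  if h : ∃ g, IsWeakPartial i v g then h.choose else 0

/-- `v ∈ H¹(Ω)`. -/
def MemH1 (v : L2Body) : Prop := ∀ i, ∃ g, IsWeakPartial i v g

/-- `v ∈ H²(Ω)`. -/
def MemH2 (v : L2Body) : Prop := MemH1 v ∧ ∀ i, MemH1 (weakPartial i v)

/-- `u ∈ L²(0,T;H²(Ω))`: for almost every `t` the value lies in `H²(Ω)`, and `u` together with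
its weak derivatives up to the second order is (Bochner) square integrable in time. -/
structure MemL2H2 (T : ℝ) (u : ℝ → L2Body) : Prop where
  memH2 : ∀ᵐ t ∂(volume.restrict (Ioo 0 T)), MemH2 (u t)
  memLp : MemLp u 2 (volume.restrict (Ioo 0 T))
  memLp_one : ∀ i, MemLp (fun t => weakPartial i (u t)) 2 (volume.restrict (Ioo 0 T))
  memLp_two : ∀ i k, MemLp (fun t => weakPartial k (weakPartial i (u t))) 2
    (volume.restrict (Ioo 0 T))

/-- `u ∈ (C²([0,T];L²(Ω)) ∩ L²(0,T;H²(Ω)))²`. -/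
def MemSolutionSpace (T : ℝ) (u : Fin 2 → ℝ → L2Body) : Prop :=
  ∀ j, ContDiffOn ℝ 2 (u j) (Icc 0 T) ∧ MemL2H2 T (u j)

/-- The sequence of `C¹` functions `ψ n` converges to `v` in the norm of `H¹(Ω)`. -/
def TendstoH1 (ψ : ℕ → Plane → ℝ) (v : L2Body) : Prop :=
  MemH1 v ∧
  Tendsto (fun n => eLpNorm (fun x => ψ n x - v x) 2 (volume.restrict body)) atTop (𝓝 0) ∧
  ∀ i, Tendsto (fun n => eLpNorm (fun x => partialD i (ψ n) x - weakPartial i v x) 2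
    (volume.restrict body)) atTop (𝓝 0)

/-- `v ∈ H¹₀(Ω)`, the closure of `C_c^∞(Ω)` in `H¹(Ω)`. -/
def MemH10 (v : L2Body) : Prop :=
  ∃ ψ : ℕ → Plane → ℝ, (∀ n, IsTest (ψ n)) ∧ TendstoH1 ψ v

/-- `g ∈ L²(∂Ω)` is the trace of `v ∈ H¹(Ω)` on the boundary: the limit in `L²(∂Ω)` of the
restrictions of smooth functions that approximate `v` in `H¹(Ω)`. -/
def IsTrace (v : L2Body) (g : Lp ℝ 2 arcLength) : Prop :=
  ∃ ψ : ℕ → Plane → ℝ, (∀ n, ContDiff ℝ ∞ (ψ n)) ∧ TendstoH1 ψ v ∧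
    Tendsto (fun n => eLpNorm (fun x => ψ n x - g x) 2 arcLength) atTop (𝓝 0)

/-- `Δ v`, in the weak sense. -/
def laplacian (v : L2Body) : L2Body := ∑ k, weakPartial k (weakPartial k v)

/-- `div v`, in the weak sense. -/
def divergence (v : Fin 2 → L2Body) : L2Body := ∑ k, weakPartial k (v k)

/-- The normal stress `σⱼ = λ div v + 2 μ ∂vⱼ/∂xⱼ`. -/
def normalStress (lam μ : ℝ) (v : Fin 2 → L2Body) (j : Fin 2) : L2Body :=
  lam • divergence v + (2 * μ) • weakPartial j (v j)

/-- The shear stress `τ = μ (∂v₁/∂x₂ + ∂v₂/∂x₁)`. -/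
def shearStress (μ : ℝ) (v : Fin 2 → L2Body) : L2Body :=
  μ • (weakPartial 1 (v 0) + weakPartial 0 (v 1))

/-- The data `(φ, X, u₀, u₀*, u_T)`, in
`L¹(0,T) × L¹(0,T;L¹(∂Ω))² × L¹(Ω)² × L¹(Ω)² × L¹(Ω)²`. -/
structure SystemData (T : ℝ) where
  /-- the time profile of the body force -/
  φ : Lp ℝ 1 (volume.restrict (Ioo 0 T))
  /-- the surface stress -/
  X : Fin 2 → Lp (Lp ℝ 1 arcLength) 1 (volume.restrict (Ioo 0 T))
  /-- the initial displacement -/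
  u₀ : Fin 2 → Lp ℝ 1 (volume.restrict body)
  /-- the initial velocity -/
  v₀ : Fin 2 → Lp ℝ 1 (volume.restrict body)
  /-- the final displacement -/
  uT : Fin 2 → Lp ℝ 1 (volume.restrict body)

/-- The pair `(u, f)` satisfies the clamped Lamé system with final displacement and surface
stress, for the Lamé constants `lam`, `μ` and the data `I`. -/
structure IsSolution (T lam μ : ℝ) (I : SystemData T)
    (u : Fin 2 → ℝ → L2Body) (f : Fin 2 → L2Body) : Prop where
  /-- `∂²uⱼ/∂t² = μ Δuⱼ + (λ + μ) ∂(div u)/∂xⱼ + φ(t) fⱼ` in `Ω × (0,T)` -/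
  lame : ∀ᵐ t ∂(volume.restrict (Ioo 0 T)), ∀ j,
    iteratedDerivWithin 2 (u j) (Icc 0 T) t =
      μ • laplacian (u j t) + (lam + μ) • weakPartial j (divergence fun k => u k t)
        + I.φ t • f j
  /-- `u = 0` on `∂Ω` -/
  clamped : ∀ᵐ t ∂(volume.restrict (Ioo 0 T)), ∀ j, MemH10 (u j t)
  /-- `u(·,0) = u₀` -/
  initial : ∀ j, u j 0 =ᵐ[volume.restrict body] I.u₀ j
  /-- `∂u/∂t(·,0) = u₀*` -/
  velocity : ∀ j, ((derivWithin (u j) (Icc 0 T) 0 : L2Body) : Plane → ℝ) =ᵐ[volume.restrict body] I.v₀ j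
  /-- `u(·,T) = u_T` -/
  final : ∀ j, u j T =ᵐ[volume.restrict body] I.uT j
  /-- `n₁σ₁ + n₂τ = X₁` and `n₂σ₂ + n₁τ = X₂` on `∂Ω`, with the traces of `σ₁`, `σ₂`, `τ` -/
  surface : ∀ᵐ t ∂(volume.restrict (Ioo 0 T)),
    ∃ σ₁ σ₂ τ : Lp ℝ 2 arcLength,
      IsTrace (normalStress lam μ (fun k => u k t) 0) σ₁ ∧
      IsTrace (normalStress lam μ (fun k => u k t) 1) σ₂ ∧
      IsTrace (shearStress μ fun k => u k t) τ ∧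
      (∀ᵐ x ∂arcLength, normal x 0 * σ₁ x + normal x 1 * τ x = I.X 0 t x) ∧
      (∀ᵐ x ∂arcLength, normal x 1 * σ₂ x + normal x 0 * τ x = I.X 1 t x)

end

end LameSource

namespace LameSource

noncomputable section

/-! Test both solutions against plane waves `cos(ξ·x + θ)` on the square. Since `u` is clamped and
its traction is prescribed, integrating the Lamé operator by parts twice leaves one boundary term,
which depends only on `X`. It is common to both solutions, so it cancels in the difference: the
difference extended by zero behaves like a field on the whole plane, and its Fourier coefficients
satisfy a closed linear ODE in `t` for each `ξ`.

The symbol of the Lamé operator has eigenvectors `ξ` and `(-ξ₂, ξ₁)`, with eigenvalues `k² =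
(λ+2μ)|ξ|²` and `μ|ξ|²`. Each component of the coefficient of the difference is thus a scalar
oscillator `Y'' + k²Y = Gφ` with `Y(0) = Y'(0) = 0`, where `G` is the same component of the
coefficient of `f - f'`. Duhamel's formula (`duhamel`, applied in `IsSolution.duhamel_coeff`) gives
`k Y(s) = G ∫₀ˢ sin(k(s-t)) φ(t) dt`.

At `s = T` the left side vanishes, as both solutions end at `u_T`. The integral is an entire
function of `k`, not identically zero because the sine transform on `(0,T)` is injective, so its
zeros are isolated (`eventually_integral_sin_mul_ne_zero`). Hence `G = 0` for all multiples of `ξ`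
close to `ξ` itself but different from it. Continuity in the wave vector and injectivity of the
Fourier transform then give `f = f'`. With equal sources, `k Y(s) = 0` and `k > 0` give `u = u'`. -/

/-! ### Injectivity of the Fourier, cosine and sine transforms -/

/-- Injectivity of the Fourier transform on `L¹`. -/
theorem ae_eq_zero_of_integral_mul_exp_eq_zero {V : Type*} [NormedAddCommGroup V]
    [InnerProductSpace ℝ V] [CompleteSpace V] [SecondCountableTopology V] [MeasurableSpace V]
    [BorelSpace V] {ν : Measure V} {h : V → ℝ} (hh : Integrable h ν)
    (h0 : ∀ t : V, ∫ x, (h x : ℂ) * Complex.exp (inner ℝ x t * Complex.I) ∂ν = 0) :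
    h =ᵐ[ν] 0 := by
  have hm : AEMeasurable h ν := hh.aemeasurable
  have hp : AEMeasurable (fun x => ENNReal.ofReal (h x)) ν := hm.ennreal_ofReal
  have hn : AEMeasurable (fun x => ENNReal.ofReal (-h x)) ν := hm.neg.ennreal_ofReal
  have hpi : ∫⁻ x, ENNReal.ofReal (h x) ∂ν ≠ ⊤ := hh.lintegral_lt_top.ne
  have hni : ∫⁻ x, ENNReal.ofReal (-h x) ∂ν ≠ ⊤ := hh.neg.lintegral_lt_top.ne
  have : IsFiniteMeasure (ν.withDensity fun x => ENNReal.ofReal (h x)) :=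
    isFiniteMeasure_withDensity hpi
  have : IsFiniteMeasure (ν.withDensity fun x => ENNReal.ofReal (-h x)) :=
    isFiniteMeasure_withDensity hni
  have hexp : ∀ t : V, Continuous fun x : V => Complex.exp (inner ℝ x t * Complex.I) :=
    fun t => by fun_prop
  have hint : ∀ (g : V → ℝ) (t : V), Integrable g ν →
      Integrable (fun x => g x • Complex.exp (inner ℝ x t * Complex.I)) ν := by
    intro g t hg
    refine hg.smul_bdd 1 (hexp t).aestronglyMeasurable (ae_of_all _ fun x => ?_)
    rw [Complex.norm_exp_ofReal_mul_I]
  -- Characteristic functions determine finite positive measures, so the signed `h` is split: its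
  -- positive and negative parts are densities of two measures with the same characteristic
  -- function.
  have key : (ν.withDensity fun x => ENNReal.ofReal (h x)) =
      ν.withDensity fun x => ENNReal.ofReal (-h x) := by
    apply Measure.ext_of_charFun
    funext t
    rw [charFun_apply, charFun_apply,
      integral_withDensity_eq_integral_toReal_smul₀ hp (ae_of_all _ fun _ => ENNReal.ofReal_lt_top),
      integral_withDensity_eq_integral_toReal_smul₀ hn (ae_of_all _ fun _ => ENNReal.ofReal_lt_top),
      ← sub_eq_zero, ← integral_sub]
    · rw [← h0 t]
      refine integral_congr_ae (ae_of_all _ fun x => ?_)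
      simp only [ENNReal.toReal_ofReal', Complex.real_smul]
      rcases le_total 0 (h x) with hx | hx
      · rw [max_eq_left hx, max_eq_right (by linarith)]; simp
      · rw [max_eq_right hx, max_eq_left (by linarith)]; simp
    · refine hint _ t ?_
      simpa only [ENNReal.toReal_ofReal'] using hh.pos_part
    · refine hint _ t ?_
      simpa only [ENNReal.toReal_ofReal'] using hh.neg_part
  have := (withDensity_eq_iff hp hn hpi).1 key
  filter_upwards [this] with x hx
  rcases le_total 0 (h x) with h1 | h1
  · rw [ENNReal.ofReal_of_nonpos (by linarith : -h x ≤ 0)] at hx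
    exact le_antisymm (ENNReal.ofReal_eq_zero.1 hx) h1
  · rw [ENNReal.ofReal_of_nonpos h1] at hx
    have := ENNReal.ofReal_eq_zero.1 hx.symm
    exact le_antisymm h1 (by simpa using this)

/-- The phases `0` and `-π/2` recover the real and imaginary parts of the exponential, so real waves
suffice and no complex-valued fields are needed. -/
theorem ae_eq_zero_of_integral_mul_cos_eq_zero {V : Type*} [NormedAddCommGroup V]
    [InnerProductSpace ℝ V] [CompleteSpace V] [SecondCountableTopology V] [MeasurableSpace V]
    [BorelSpace V] {ν : Measure V} {h : V → ℝ} (hh : Integrable h ν)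
    (h0 : ∀ (t : V) (θ : ℝ), ∫ x, h x * Real.cos (inner ℝ t x + θ) ∂ν = 0) :
    h =ᵐ[ν] 0 := by
  refine ae_eq_zero_of_integral_mul_exp_eq_zero hh fun t => ?_
  have hI : ∀ θ, Integrable (fun x => h x * Real.cos (inner ℝ t x + θ)) ν := fun θ =>
    hh.mul_bdd (c := 1) (by fun_prop) (ae_of_all _ fun x => Real.abs_cos_le_one _)
  have e : (fun x => (h x : ℂ) * Complex.exp (inner ℝ x t * Complex.I)) = fun x =>
      ((h x * Real.cos (inner ℝ t x + 0) : ℝ) : ℂ) +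
        ((h x * Real.cos (inner ℝ t x + -(Real.pi / 2)) : ℝ) : ℂ) * Complex.I := by
    funext x
    rw [← sub_eq_add_neg, Real.cos_sub_pi_div_two, Complex.exp_mul_I, real_inner_comm, add_zero]
    push_cast
    ring
  rw [e, integral_add (hI _).ofReal ((hI _).ofReal.mul_const _), integral_mul_const,
    integral_complex_ofReal, integral_complex_ofReal, h0, h0]
  simp

/-- If the sine transform of an integrable function on `(0, T)` vanishes, so does the function. -/
theorem ae_eq_zero_of_integral_sin_mul_eq_zero {T : ℝ} {φ : ℝ → ℝ}
    (hφ : IntegrableOn φ (Ioo 0 T))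
    (h0 : ∀ k : ℝ, ∫ t in Ioo 0 T, Real.sin (k * (T - t)) * φ t = 0) :
    φ =ᵐ[volume.restrict (Ioo 0 T)] 0 := by
  -- In the reversed time `s = T - t` the kernel is `sin(ks)`, which sees only the odd part of `A`.
  -- Since `A` vanishes for `s ≤ 0`, that odd part determines it.
  set A : ℝ → ℝ := fun s => (Ioo 0 T).indicator φ (T - s) with hA
  have hAi : Integrable A :=
    ((integrable_indicator_iff measurableSet_Ioo).2 hφ).comp_sub_left T
  have hodd : (fun s => A s - A (-s)) =ᵐ[volume] 0 := by
    refine ae_eq_zero_of_integral_mul_cos_eq_zero (hAi.sub hAi.comp_neg) fun k θ => ?_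
    have hc : ∀ θ', Integrable fun s => A s * Real.cos (k * s + θ') := fun θ' =>
      hAi.mul_bdd (c := 1) (by fun_prop) (ae_of_all _ fun x => Real.abs_cos_le_one _)
    have hc' : ∀ θ', Integrable fun s => A s * Real.cos (-(k * s) + θ') := fun θ' =>
      hAi.mul_bdd (c := 1) (by fun_prop) (ae_of_all _ fun x => Real.abs_cos_le_one _)
    have e1 : ∀ s, (A s - A (-s)) * Real.cos (inner ℝ k s + θ) =
        A s * Real.cos (k * s + θ) - A (-s) * Real.cos (-(k * -s) + θ) := by
      intro s
      have : inner ℝ k s = k * s := by simp [mul_comm]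
      rw [this, sub_mul]; ring_nf
    simp_rw [e1]
    rw [integral_sub (hc θ) (hc' θ).comp_neg,
      integral_neg_eq_self (fun s => A s * Real.cos (-(k * s) + θ)) volume,
      ← integral_sub (hc θ) (hc' θ)]
    have e2 : ∀ s, A s * Real.cos (k * s + θ) - A s * Real.cos (-(k * s) + θ) =
        (-2 * Real.sin θ) * (Real.sin (k * s) * A s) := by
      intro s
      rw [Real.cos_add, Real.cos_add, Real.cos_neg, Real.sin_neg]; ring
    simp_rw [e2]
    rw [integral_const_mul]
    have e3 : ∫ s, Real.sin (k * s) * A s = 0 := by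
      rw [← integral_sub_left_eq_self _ volume T, ← h0 k,
        ← integral_indicator measurableSet_Ioo]
      refine integral_congr_ae (ae_of_all _ fun t => ?_)
      by_cases ht : t ∈ Ioo 0 T
      · simp only [hA, sub_sub_cancel, indicator_of_mem ht]
      · simp only [hA, sub_sub_cancel, indicator_of_notMem ht, mul_zero]
    rw [e3, mul_zero]
  have hz : A =ᵐ[volume] 0 := by
    filter_upwards [hodd] with s hs
    simp only [Pi.zero_apply] at hs ⊢
    by_cases h : 0 < s
    · have : A (-s) = 0 := by
        simp only [hA]; rw [indicator_of_notMem]; simp; intro; linarith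
      linarith
    · simp only [hA]; rw [indicator_of_notMem]; simp; intro; linarith
  have hz' : (Ioo 0 T).indicator φ =ᵐ[volume] 0 := by
    have := (Measure.measurePreserving_sub_left volume T).quasiMeasurePreserving.ae_eq_comp hz
    refine (Filter.EventuallyEq.trans (ae_of_all _ fun t => ?_) this)
    simp [hA]
  filter_upwards [ae_restrict_of_ae hz', ae_restrict_mem measurableSet_Ioo] with t h1 h2
  rwa [indicator_of_mem h2] at h1

/-! ### Zeros of the sine transform, and the forced oscillator -/

/-- The sine transform of a nonzero integrable function on `(0, T)` has isolated zeros. -/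
theorem eventually_integral_sin_mul_ne_zero {T : ℝ} {φ : ℝ → ℝ}
    (hφ : IntegrableOn φ (Ioo 0 T)) (hne : ¬ φ =ᵐ[volume.restrict (Ioo 0 T)] 0) (k₀ : ℝ) :
    ∀ᶠ k in 𝓝[≠] k₀, ∫ t in Ioo 0 T, Real.sin (k * (T - t)) * φ t ≠ 0 := by
  set D : ℂ → ℂ := fun z => ∫ t in Ioo 0 T, Complex.sin (z * (T - t)) * φ t with hD
  have hDr : ∀ k : ℝ, D k = ((∫ t in Ioo 0 T, Real.sin (k * (T - t)) * φ t : ℝ) : ℂ) := by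
    intro k
    rw [← integral_complex_ofReal]
    simp [hD]
  have hdiff : Differentiable ℂ D := by
    intro z
    have hb : ∀ (g : ℝ → ℂ), Continuous g → Integrable (fun t => g t * (φ t : ℂ))
        (volume.restrict (Ioo 0 T)) := by
      intro g hg
      obtain ⟨C, hC⟩ := (isCompact_Icc (a := (0 : ℝ)) (b := T)).exists_bound_of_continuousOn
        hg.continuousOn
      refine hφ.ofReal.bdd_mul (c := C) hg.aestronglyMeasurable ?_
      filter_upwards [ae_restrict_mem measurableSet_Ioo] with t ht
      exact hC t (Ioo_subset_Icc_self ht)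
    obtain ⟨C, hC⟩ := ((isCompact_closedBall z 1).prod
      (isCompact_Icc (a := (0 : ℝ)) (b := T))).exists_bound_of_continuousOn
        (f := fun p : ℂ × ℝ => Complex.cos (p.1 * (T - p.2)) * (T - p.2))
        (by fun_prop)
    have := hasDerivAt_integral_of_dominated_loc_of_deriv_le
      (μ := volume.restrict (Ioo 0 T)) (𝕜 := ℂ)
      (F := fun w t => Complex.sin (w * (T - t)) * φ t)
      (F' := fun w t => Complex.cos (w * (T - t)) * (T - t) * φ t)
      (x₀ := z) (bound := fun t => C * ‖φ t‖) (Metric.closedBall_mem_nhds z one_pos)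
      (Eventually.of_forall fun w => (hb _ (by fun_prop)).aestronglyMeasurable)
      (hb _ (by fun_prop)) (hb _ (by fun_prop)).aestronglyMeasurable ?_
      (hφ.norm.const_mul C) ?_
    · exact this.2.differentiableAt
    · filter_upwards [ae_restrict_mem measurableSet_Ioo] with t ht w hw
      rw [norm_mul, Complex.norm_real]
      gcongr
      exact hC (w, t) ⟨hw, Ioo_subset_Icc_self ht⟩
    · refine ae_of_all _ fun t w _ => ?_
      have := (((hasDerivAt_id w).mul_const ((T : ℂ) - t)).csin).mul_const (φ t : ℂ)
      simpa using this
  have han : AnalyticAt ℂ D k₀ := hdiff.analyticAt _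
  rcases han.eventually_eq_zero_or_eventually_ne_zero with h | h
  · exfalso
    have hall : D = 0 := by
      refine AnalyticOnNhd.eq_of_eventuallyEq (z₀ := (k₀ : ℂ)) (fun z _ => hdiff.analyticAt z)
        (fun z _ => analyticAt_const) h
    apply hne
    refine ae_eq_zero_of_integral_sin_mul_eq_zero hφ fun k => ?_
    have := hDr k
    rw [hall] at this
    exact Complex.ofReal_eq_zero.1 (by simpa using this.symm)
  · have ht : Tendsto (fun k : ℝ => (k : ℂ)) (𝓝[≠] k₀) (𝓝[≠] (k₀ : ℂ)) := by
      refine tendsto_nhdsWithin_of_tendsto_nhds_of_eventually_within _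
        (Complex.continuous_ofReal.continuousAt.tendsto.mono_left nhdsWithin_le_nhds) ?_
      filter_upwards [self_mem_nhdsWithin] with k hk
      simpa using hk
    filter_upwards [ht.eventually h] with k hk h0
    apply hk
    rw [hDr, h0]; simp

/-- Duhamel's formula for the forced harmonic oscillator at rest at time `0`. -/
theorem duhamel {T k G : ℝ} (hT : 0 < T) {φ Y : ℝ → ℝ} (hY : ContDiffOn ℝ 2 Y (Icc 0 T))
    (h0 : Y 0 = 0) (h1 : derivWithin Y (Icc 0 T) 0 = 0)
    (hode : ∀ᵐ t ∂(volume.restrict (Ioo 0 T)),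
      iteratedDerivWithin 2 Y (Icc 0 T) t = -(k ^ 2 * Y t) + φ t * G)
    {s : ℝ} (hs : s ∈ Icc 0 T) :
    k * Y s = G * ∫ t in Ioo 0 s, Real.sin (k * (s - t)) * φ t := by
  have hu := uniqueDiffOn_Icc hT
  set I := Icc 0 T
  set Y1 := derivWithin Y I with hY1
  have e2 : iteratedDerivWithin 2 Y I = derivWithin Y1 I := by
    rw [iteratedDerivWithin_succ, iteratedDerivWithin_one]
  have c1 : ContDiffOn ℝ 1 Y1 I := hY.derivWithin hu (by norm_num)
  have c2 : ContinuousOn (derivWithin Y1 I) I := c1.continuousOn_derivWithin hu le_rfl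
  have hsub : Ioo 0 s ⊆ Ioo 0 T := Ioo_subset_Ioo_right hs.2
  have hsub' : Icc 0 s ⊆ I := Icc_subset_Icc_right hs.2
  have hd0 : ∀ t ∈ Ioo 0 T, HasDerivAt Y (Y1 t) t := fun t ht =>
    ((hY.differentiableOn (by norm_num) t (Ioo_subset_Icc_self ht)).hasDerivWithinAt).hasDerivAt
      (Icc_mem_nhds ht.1 ht.2)
  have hd1 : ∀ t ∈ Ioo 0 T, HasDerivAt Y1 (derivWithin Y1 I t) t := fun t ht =>
    ((c1.differentiableOn (by norm_num) t (Ioo_subset_Icc_self ht)).hasDerivWithinAt).hasDerivAt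
      (Icc_mem_nhds ht.1 ht.2)
  -- The primitive is chosen so that its `Y'cos` terms cancel on differentiation; it equals `kY(s)`
  -- at `t = s` and `0` at `t = 0`. The integrand is continuous because `Y` is `C²`, so `φ` need
  -- only be integrable.
  have hftc := intervalIntegral.integral_eq_sub_of_hasDerivAt_of_le (a := 0) (b := s)
    (f := fun t => Y1 t * Real.sin (k * (s - t)) + k * Y t * Real.cos (k * (s - t)))
    (f' := fun t => (derivWithin Y1 I t + k ^ 2 * Y t) * Real.sin (k * (s - t))) hs.1 ?_ ?_ ?_
  · have hend : Y1 0 = 0 := h1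
    simp only [sub_self, mul_zero, Real.sin_zero, Real.cos_zero, hend, h0, zero_mul, mul_one,
      zero_add, sub_zero, add_zero] at hftc
    rw [← hftc, intervalIntegral.integral_of_le hs.1, integral_Ioc_eq_integral_Ioo,
      ← integral_const_mul]
    refine integral_congr_ae ?_
    filter_upwards [ae_restrict_of_ae_restrict_of_subset hsub hode] with t ht
    rw [← e2, ht]; ring
  · exact ((c1.continuousOn.mono hsub').mul (by fun_prop)).add
      ((continuousOn_const.mul (hY.continuousOn.mono hsub')).mul (by fun_prop))
  · intro t ht
    have hl : HasDerivAt (fun t => k * (s - t)) (-k) t := by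
      simpa using ((hasDerivAt_id t).const_sub s).const_mul k
    have := ((hd1 t (hsub ht)).mul hl.sin).add (((hd0 t (hsub ht)).const_mul k).mul hl.cos)
    refine HasDerivAt.congr_deriv this ?_
    ring
  · refine ContinuousOn.intervalIntegrable ?_
    rw [uIcc_of_le hs.1]
    exact ((c2.mono hsub').add (continuousOn_const.mul (hY.continuousOn.mono hsub'))).mul
      (by fun_prop)

/-! ### The square, its boundary measure, and classical derivatives -/

theorem isOpen_body : IsOpen body := by
  have : body = ⋂ i, (fun x : Plane => x i) ⁻¹' Ioo 0 1 := by
    ext x; simp [body]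
  rw [this]
  exact isOpen_iInter_of_finite fun i => isOpen_Ioo.preimage (by fun_prop)

theorem measurableSet_body : MeasurableSet body := isOpen_body.measurableSet

theorem norm_le_two_of_mem_Icc {x : Plane} (hx : ∀ i, x i ∈ Icc (0 : ℝ) 1) : ‖x‖ ≤ 2 := by
  rw [EuclideanSpace.norm_eq, Fin.sum_univ_two, Real.sqrt_le_left (by norm_num)]
  have h0 := hx 0
  have h1 := hx 1
  simp only [Real.norm_eq_abs, sq_abs]
  nlinarith [h0.1, h0.2, h1.1, h1.2]

theorem body_subset_closedBall : body ⊆ Metric.closedBall 0 2 := fun x hx => by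
  simpa using norm_le_two_of_mem_Icc fun i => Ioo_subset_Icc_self (hx i)

instance : IsFiniteMeasure (volume.restrict body) := by
  refine ⟨?_⟩
  rw [Measure.restrict_apply_univ]
  exact (measure_mono body_subset_closedBall).trans_lt measure_closedBall_lt_top

instance : IsFiniteMeasure arcLength := by
  unfold arcLength; infer_instance

theorem continuous_side (i : Fin 2) (b : ℝ) : Continuous (side i b) := by
  unfold side
  refine (PiLp.continuous_toLp 2 _).comp ?_
  exact (continuous_pi fun _ => continuous_id).update i continuous_const

theorem side_apply_self (i : Fin 2) (b s : ℝ) : side i b s i = b := by simp [side]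

theorem side_apply_ne {i j : Fin 2} (h : j ≠ i) (b s : ℝ) : side i b s j = s := by
  simp [side, h]

/-- A property holds almost everywhere on the boundary once it holds on the open sides. -/
theorem ae_arcLength {p : Plane → Prop} (hp : MeasurableSet {x | p x})
    (h : ∀ i b, b = 0 ∨ b = 1 → ∀ s ∈ Ioo (0 : ℝ) 1, p (side i b s)) :
    ∀ᵐ x ∂arcLength, p x := by
  have hside : ∀ i b, b = 0 ∨ b = 1 →
      ∀ᵐ x ∂((volume.restrict (Icc (0 : ℝ) 1)).map (side i b)), p x := by
    intro i b hb
    rw [ae_map_iff (continuous_side i b).aemeasurable hp, ← restrict_Ioo_eq_restrict_Icc]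
    filter_upwards [ae_restrict_mem measurableSet_Ioo] with s hs using h i b hb s hs
  unfold arcLength
  rw [Fin.sum_univ_two]
  simp only [ae_add_measure_iff]
  exact ⟨⟨hside 0 0 (.inl rfl), hside 0 1 (.inr rfl)⟩, hside 1 0 (.inl rfl), hside 1 1 (.inr rfl)⟩

theorem ae_arcLength_norm_le : ∀ᵐ x ∂arcLength, ‖x‖ ≤ 2 := by
  refine ae_arcLength (measurableSet_le measurable_norm measurable_const) fun i b hb s hs => ?_
  refine norm_le_two_of_mem_Icc fun j => ?_
  rcases eq_or_ne j i with rfl | hj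
  · rw [side_apply_self]; rcases hb with rfl | rfl <;> simp
  · rw [side_apply_ne hj]; exact Ioo_subset_Icc_self hs

theorem memLp_of_continuous {m : Measure Plane} [IsFiniteMeasure m] (hm : ∀ᵐ x ∂m, ‖x‖ ≤ 2)
    {F : Plane → ℝ} (hF : Continuous F) (p : ℝ≥0∞) : MemLp F p m := by
  obtain ⟨C, hC⟩ := (isCompact_closedBall (0 : Plane) 2).exists_bound_of_continuousOn
    hF.continuousOn
  refine MemLp.of_bound hF.aestronglyMeasurable C ?_
  filter_upwards [hm] with x hx using hC x (by simpa using hx)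

theorem ae_body_norm_le : ∀ᵐ x ∂(volume.restrict body), ‖x‖ ≤ 2 := by
  filter_upwards [ae_restrict_mem measurableSet_body] with x hx
  simpa using body_subset_closedBall hx

theorem continuous_partialD {F : Plane → ℝ} (hF : ContDiff ℝ 1 F) (i : Fin 2) :
    Continuous (partialD i F) :=
  (hF.continuous_fderiv (by norm_num)).clm_apply continuous_const

theorem contDiff_partialD {F : Plane → ℝ} (hF : ContDiff ℝ ∞ F) (i : Fin 2) :
    ContDiff ℝ ∞ (partialD i F) :=
  (hF.fderiv_right (m := ∞) le_rfl).clm_apply contDiff_const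

theorem partialD_mul {F G : Plane → ℝ} (hF : ContDiff ℝ 1 F) (hG : ContDiff ℝ 1 G) (i : Fin 2)
    (x : Plane) : partialD i (fun y => F y * G y) x = partialD i F x * G x + F x * partialD i G x := by
  unfold partialD
  rw [fderiv_fun_mul (hF.differentiable (by norm_num) x) (hG.differentiable (by norm_num) x)]
  simp; ring

theorem partialD_comm {F : Plane → ℝ} (hF : ContDiff ℝ ∞ F) (i k : Fin 2) :
    partialD i (partialD k F) = partialD k (partialD i F) := by
  funext x
  have hF2 : ContDiff ℝ 2 F := contDiff_infty.1 hF 2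
  have hd : DifferentiableAt ℝ (fderiv ℝ F) x :=
    (hF2.fderiv_right (m := 1) (by norm_num)).differentiable (by norm_num) x
  have h : ∀ a b : Fin 2, partialD a (partialD b F) x =
      fderiv ℝ (fderiv ℝ F) x (EuclideanSpace.single a 1) (EuclideanSpace.single b 1) := by
    intro a b
    have : partialD b F = fun y => fderiv ℝ F y (EuclideanSpace.single b 1) := rfl
    rw [this]
    unfold partialD
    rw [fderiv_clm_apply hd (differentiableAt_const _)]
    simp
  rw [h, h]
  exact (hF2.contDiffAt.isSymmSndFDerivAt (by simp)) _ _

theorem IsTest.partialD {ψ : Plane → ℝ} (h : IsTest ψ) (i : Fin 2) :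
    IsTest (LameSource.partialD i ψ) where
  smooth := contDiff_partialD h.smooth i
  compact := h.compact.fderiv_apply (𝕜 := ℝ) _
  support := (tsupport_fderiv_apply_subset ℝ _).trans h.support

/-! ### Weak derivatives -/

theorem integrable_mul_of_continuous (v : L2Body) {F : Plane → ℝ} (hF : Continuous F) :
    Integrable (fun x => v x * F x) (volume.restrict body) :=
  (Lp.memLp v).integrable_mul (memLp_of_continuous ae_body_norm_le hF 2)

/-- Weak partial derivatives are unique. -/
theorem IsWeakPartial.unique {i : Fin 2} {v g g' : L2Body} (h : IsWeakPartial i v g)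
    (h' : IsWeakPartial i v g') : g = g' := by
  have hi : Integrable (fun x => g x - g' x) (volume.restrict body) :=
    ((Lp.memLp g).integrable (by norm_num)).sub ((Lp.memLp g').integrable (by norm_num))
  have := isOpen_body.ae_eq_zero_of_integral_contDiff_smul_eq_zero (μ := volume)
    (f := fun x => g x - g' x) (IntegrableOn.locallyIntegrableOn hi) fun ψ hs hc ht => by
      have hψ : IsTest ψ := ⟨hs, hc, ht⟩
      have e : ∫ x in body, (g x * ψ x - g' x * ψ x) = 0 := by
        rw [integral_sub (integrable_mul_of_continuous g hs.continuous)
          (integrable_mul_of_continuous g' hs.continuous)]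
        have := h ψ hψ
        have := h' ψ hψ
        linarith
      rw [← setIntegral_eq_integral_of_forall_compl_eq_zero (s := body), ← e]
      · refine integral_congr_ae (ae_of_all _ fun x => ?_)
        simp only [smul_eq_mul]; ring
      · intro x hx
        rw [image_eq_zero_of_notMem_tsupport fun hx' => hx (ht hx'), zero_smul]
  refine Lp.ext ((ae_restrict_iff' measurableSet_body).2 ?_)
  filter_upwards [this] with x hx hxb
  linarith [hx hxb]

theorem MemH1.isWeakPartial {v : L2Body} (h : MemH1 v) (i : Fin 2) :
    IsWeakPartial i v (weakPartial i v) := by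
  unfold weakPartial
  rw [dif_pos (h i)]
  exact (h i).choose_spec

theorem IsWeakPartial.weakPartial_eq {i : Fin 2} {v g : L2Body} (h : IsWeakPartial i v g) :
    weakPartial i v = g := by
  have hex : ∃ g, IsWeakPartial i v g := ⟨g, h⟩
  unfold weakPartial
  rw [dif_pos hex]
  exact hex.choose_spec.unique h

theorem integral_add_mul (v w : L2Body) {F : Plane → ℝ} (hF : Continuous F) :
    ∫ x in body, (v + w : L2Body) x * F x = (∫ x in body, v x * F x) + ∫ x in body, w x * F x := by
  rw [← integral_add (integrable_mul_of_continuous v hF) (integrable_mul_of_continuous w hF)]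
  refine integral_congr_ae ?_
  filter_upwards [Lp.coeFn_add v w] with x hx
  rw [hx, Pi.add_apply, add_mul]

theorem integral_smul_mul (c : ℝ) (v : L2Body) (F : Plane → ℝ) :
    ∫ x in body, (c • v : L2Body) x * F x = c * ∫ x in body, v x * F x := by
  rw [← integral_const_mul]
  refine integral_congr_ae ?_
  filter_upwards [Lp.coeFn_smul c v] with x hx
  rw [hx, Pi.smul_apply, smul_eq_mul, mul_assoc]

theorem IsWeakPartial.add {i : Fin 2} {v w g k : L2Body} (h : IsWeakPartial i v g)
    (h' : IsWeakPartial i w k) : IsWeakPartial i (v + w) (g + k) := fun ψ hψ => by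
  rw [integral_add_mul _ _ (hψ.partialD i).smooth.continuous,
    integral_add_mul _ _ hψ.smooth.continuous, h ψ hψ, h' ψ hψ]
  ring

theorem IsWeakPartial.smul {i : Fin 2} {v g : L2Body} (c : ℝ) (h : IsWeakPartial i v g) :
    IsWeakPartial i (c • v) (c • g) := fun ψ hψ => by
  rw [integral_smul_mul, integral_smul_mul, h ψ hψ]
  ring

theorem MemH2.weakPartial_comm {v : L2Body} (h : MemH2 v) (i k : Fin 2) :
    weakPartial k (weakPartial i v) = weakPartial i (weakPartial k v) := by
  refine IsWeakPartial.weakPartial_eq fun ψ hψ => ?_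
  have h1 := h.1.isWeakPartial i _ (hψ.partialD k)
  have h2 := h.1.isWeakPartial k _ (hψ.partialD i)
  have h3 := (h.2 k).isWeakPartial i _ hψ
  rw [partialD_comm hψ.smooth] at h1
  linarith

/-! ### The Lamé operator as the divergence of the stress -/

/-- The Lamé operator `μ Δ vⱼ + (λ + μ) ∂ⱼ div v`. -/
def lameOperator (lam μ : ℝ) (v : Fin 2 → L2Body) (j : Fin 2) : L2Body :=
  μ • laplacian (v j) + (lam + μ) • weakPartial j (divergence v)

theorem isWeakPartial_divergence {v : Fin 2 → L2Body} (h : ∀ j, MemH2 (v j)) (i : Fin 2) :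
    IsWeakPartial i (divergence v)
      (weakPartial i (weakPartial 0 (v 0)) + weakPartial i (weakPartial 1 (v 1))) := by
  unfold divergence
  rw [Fin.sum_univ_two]
  exact (((h 0).2 0).isWeakPartial i).add (((h 1).2 1).isWeakPartial i)

theorem isWeakPartial_normalStress {v : Fin 2 → L2Body} (h : ∀ j, MemH2 (v j)) (lam μ : ℝ)
    (j i : Fin 2) :
    IsWeakPartial i (normalStress lam μ v j)
      (lam • (weakPartial i (weakPartial 0 (v 0)) + weakPartial i (weakPartial 1 (v 1)))
        + (2 * μ) • weakPartial i (weakPartial j (v j))) :=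
  ((isWeakPartial_divergence h i).smul lam).add ((((h j).2 j).isWeakPartial i).smul (2 * μ))

theorem isWeakPartial_shearStress {v : Fin 2 → L2Body} (h : ∀ j, MemH2 (v j)) (μ : ℝ)
    (i : Fin 2) :
    IsWeakPartial i (shearStress μ v)
      (μ • (weakPartial i (weakPartial 1 (v 0)) + weakPartial i (weakPartial 0 (v 1)))) :=
  ((((h 0).2 1).isWeakPartial i).add (((h 1).2 0).isWeakPartial i)).smul μ

/-- Divergence form is what makes the traction `n₁σ₁ + n₂τ` appear as the boundary term of an
integration by parts. The mixed derivative of the other component has to be commuted, hence the `H²`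
hypothesis. -/
theorem lameOperator_zero {v : Fin 2 → L2Body} (h : ∀ j, MemH2 (v j)) (lam μ : ℝ) :
    lameOperator lam μ v 0 =
      weakPartial 0 (normalStress lam μ v 0) + weakPartial 1 (shearStress μ v) := by
  rw [(isWeakPartial_normalStress h lam μ 0 0).weakPartial_eq,
    (isWeakPartial_shearStress h μ 1).weakPartial_eq, lameOperator,
    (isWeakPartial_divergence h 0).weakPartial_eq, laplacian, Fin.sum_univ_two,
    (h 1).weakPartial_comm 0 1]
  module

theorem lameOperator_one {v : Fin 2 → L2Body} (h : ∀ j, MemH2 (v j)) (lam μ : ℝ) :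
    lameOperator lam μ v 1 =
      weakPartial 1 (normalStress lam μ v 1) + weakPartial 0 (shearStress μ v) := by
  rw [(isWeakPartial_normalStress h lam μ 1 1).weakPartial_eq,
    (isWeakPartial_shearStress h μ 0).weakPartial_eq, lameOperator,
    (isWeakPartial_divergence h 1).weakPartial_eq, laplacian, Fin.sum_univ_two,
    (h 0).weakPartial_comm 1 0]
  module

/-! ### The divergence theorem and Green's formula on the square -/

theorem measurePreserving_side (i : Fin 2) :
    MeasurePreserving (fun p : ℝ × ℝ => side i p.2 p.1) (volume.prod volume) volume := by
  have h : MeasurePreserving (fun p : ℝ × ℝ => side 1 p.2 p.1) (volume.prod volume) volume := by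
    have := (PiLp.volume_preserving_toLp (Fin 2)).comp (volume_preserving_finTwoArrow ℝ).symm
    have e : (fun p : ℝ × ℝ => side 1 p.2 p.1) =
        WithLp.toLp 2 ∘ MeasurableEquiv.finTwoArrow.symm := by
      funext p
      refine PiLp.ext fun k => ?_
      fin_cases k
      · exact side_apply_ne (by decide) _ _
      · exact side_apply_self _ _ _
    rw [e]
    exact this
  fin_cases i
  · have := h.comp (Measure.measurePreserving_swap (μ := (volume : Measure ℝ)) (ν := volume))
    convert this using 1
    funext p
    refine PiLp.ext fun k => ?_
    fin_cases k
    · exact (side_apply_self _ _ _).trans (side_apply_ne (by decide) _ _).symm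
    · exact (side_apply_ne (by decide) _ _).trans (side_apply_self _ _ _).symm
  · exact h

theorem side_mem_body {i : Fin 2} {b s : ℝ} :
    side i b s ∈ body ↔ s ∈ Ioo (0 : ℝ) 1 ∧ b ∈ Ioo (0 : ℝ) 1 := by
  constructor
  · intro h
    obtain ⟨j, hj⟩ := exists_ne i
    have h1 := h j
    have h2 := h i
    rw [side_apply_ne hj] at h1
    rw [side_apply_self] at h2
    exact ⟨h1, h2⟩
  · rintro ⟨h1, h2⟩ j
    rcases eq_or_ne j i with rfl | hj
    · rwa [side_apply_self]
    · rwa [side_apply_ne hj]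

theorem integral_body_eq {H : Plane → ℝ} (hH : Continuous H) (i : Fin 2) :
    ∫ x in body, H x = ∫ s in Ioo (0 : ℝ) 1, ∫ b in Ioo (0 : ℝ) 1, H (side i b s) := by
  have mp := measurePreserving_side i
  have hpre : (fun p : ℝ × ℝ => side i p.2 p.1) ⁻¹' body = Ioo (0 : ℝ) 1 ×ˢ Ioo (0 : ℝ) 1 := by
    ext p; exact side_mem_body
  have mpr := mp.restrict_preimage measurableSet_body
  rw [hpre] at mpr
  have hint : Integrable H (volume.restrict body) :=
    memLp_one_iff_integrable.1 (memLp_of_continuous ae_body_norm_le hH 1)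
  rw [← setIntegral_prod (fun p : ℝ × ℝ => H (side i p.2 p.1))
    ((mpr.integrable_comp hint.aestronglyMeasurable).2 hint), ← mpr.map_eq,
    integral_map mpr.measurable.aemeasurable hH.aestronglyMeasurable]

theorem hasDerivAt_side {F : Plane → ℝ} (hF : ContDiff ℝ 1 F) (i : Fin 2) (b s : ℝ) :
    HasDerivAt (fun b => F (side i b s)) (partialD i F (side i b s)) b := by
  have e : ∀ b, side i b s = side i 0 s + b • EuclideanSpace.single i (1 : ℝ) := by
    intro b
    refine PiLp.ext fun k => ?_
    rcases eq_or_ne k i with rfl | hk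
    · simp [side_apply_self]
    · simp [side_apply_ne hk, hk]
  have h1 : HasDerivAt (fun b => side i b s) (EuclideanSpace.single i (1 : ℝ)) b := by
    rw [funext e]
    simpa using ((hasDerivAt_id b).smul_const (EuclideanSpace.single i (1 : ℝ))).const_add
      (side i 0 s)
  exact (hF.differentiable (by norm_num) _).hasFDerivAt.comp_hasDerivAt b h1

theorem measurable_normal (i : Fin 2) : Measurable fun x : Plane => normal x i := by
  unfold normal
  have h (c : ℝ) : MeasurableSet {x : Plane | x i = c} :=
    (measurableSet_singleton c).preimage (by fun_prop : Measurable fun x : Plane => x i)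
  exact Measurable.ite (h 1) measurable_const (Measurable.ite (h 0) measurable_const
    measurable_const)

theorem norm_normal_le (x : Plane) (i : Fin 2) : ‖normal x i‖ ≤ 1 := by
  unfold normal; split_ifs <;> simp

theorem integrable_normal_mul {g : Plane → ℝ} (hg : Integrable g arcLength) (i : Fin 2) :
    Integrable (fun x => normal x i * g x) arcLength :=
  hg.bdd_mul (measurable_normal i).aestronglyMeasurable (ae_of_all _ fun x => norm_normal_le x i)

/-- The divergence theorem on the unit square. -/
theorem integral_partialD_body {F : Plane → ℝ} (hF : ContDiff ℝ 1 F) (i : Fin 2) :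
    ∫ x in body, partialD i F x = ∫ x, normal x i * F x ∂arcLength := by
  have hFc := hF.continuous
  have hI : Integrable (fun x => normal x i * F x) arcLength :=
    integrable_normal_mul (memLp_one_iff_integrable.1
      (memLp_of_continuous ae_arcLength_norm_le hFc 1)) i
  have hsm : ∀ j b, AEStronglyMeasurable (fun x => normal x i * F x)
      ((volume.restrict (Icc (0 : ℝ) 1)).map (side j b)) := fun j b =>
    ((measurable_normal i).mul hFc.measurable).aestronglyMeasurable
  have hval : ∀ j b, ∫ x, normal x i * F x ∂((volume.restrict (Icc (0 : ℝ) 1)).map (side j b)) =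
      ∫ s in Ioo (0 : ℝ) 1, normal (side j b s) i * F (side j b s) := by
    intro j b
    rw [integral_map (continuous_side j b).aemeasurable (hsm j b), restrict_Ioo_eq_restrict_Icc]
  have hself : ∀ b, (b = 0 ∨ b = 1) → ∀ s, normal (side i b s) i = 2 * b - 1 := by
    intro b hb s
    unfold normal
    rw [side_apply_self]
    rcases hb with rfl | rfl <;> norm_num
  -- The two sides parallel to the `i`-th axis contribute nothing; corners, where `normal` would be
  -- nonzero, are excluded by taking `s` in the open interval.
  have hne : ∀ j b, i ≠ j → ∀ s ∈ Ioo (0 : ℝ) 1, normal (side j b s) i = 0 := by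
    intro j b hj s hs
    unfold normal
    rw [side_apply_ne hj, if_neg hs.2.ne, if_neg hs.1.ne']
  have hi : ∀ j, Integrable (fun x => normal x i * F x)
      ((volume.restrict (Icc (0 : ℝ) 1)).map (side j 0) +
        (volume.restrict (Icc (0 : ℝ) 1)).map (side j 1)) := by
    unfold arcLength at hI
    exact fun j => integrable_finsetSum_measure.1 hI j (Finset.mem_univ j)
  have hcs : ∀ b, IntegrableOn (fun s => F (side i b s)) (Ioo 0 1) := fun b => by
    have : Continuous fun s => F (side i b s) := by
      refine hFc.comp ?_
      unfold side
      refine (PiLp.continuous_toLp 2 _).comp ?_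
      exact (continuous_pi fun _ => continuous_id).update i continuous_const
    exact (this.integrableOn_Icc (a := 0) (b := 1)).mono_set Ioo_subset_Icc_self
  have hsum : ∀ j, ∫ x, normal x i * F x ∂((volume.restrict (Icc (0 : ℝ) 1)).map (side j 0) +
        (volume.restrict (Icc (0 : ℝ) 1)).map (side j 1)) =
      if j = i then ∫ s in Ioo (0 : ℝ) 1, (F (side i 1 s) - F (side i 0 s)) else 0 := by
    intro j
    have h2 := integrable_add_measure.1 (hi j)
    rw [integral_add_measure h2.1 h2.2, hval, hval]
    split_ifs with hj
    · subst hj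
      simp_rw [hself 0 (.inl rfl), hself 1 (.inr rfl)]
      rw [integral_sub (hcs 1) (hcs 0), integral_const_mul, integral_const_mul]
      ring
    · rw [setIntegral_eq_zero_of_forall_eq_zero fun s hs => by
          rw [hne j 0 (Ne.symm hj) s hs, zero_mul],
        setIntegral_eq_zero_of_forall_eq_zero fun s hs => by
          rw [hne j 1 (Ne.symm hj) s hs, zero_mul], add_zero]
  unfold arcLength
  rw [integral_finsetSum_measure fun j _ => hi j]
  simp_rw [hsum]
  rw [Finset.sum_ite_eq' Finset.univ i, if_pos (Finset.mem_univ i),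
    integral_body_eq (continuous_partialD hF i) i]
  refine integral_congr_ae (ae_of_all _ fun s => ?_)
  have hc : Continuous fun b => partialD i F (side i b s) := by
    refine (continuous_partialD hF i).comp ?_
    unfold side
    refine (PiLp.continuous_toLp 2 _).comp ?_
    exact continuous_const.update i continuous_id
  simp only
  rw [← integral_Ioc_eq_integral_Ioo, ← intervalIntegral.integral_of_le zero_le_one]
  exact intervalIntegral.integral_eq_sub_of_hasDerivAt (fun b _ => hasDerivAt_side hF i b s)
    (hc.intervalIntegrable _ _)

/-- By Hölder, `L²` convergence survives pairing with a fixed `L²` function. It carries the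
divergence theorem from smooth approximants to Sobolev functions and their traces. -/
theorem tendsto_integral_mul_of_tendsto_eLpNorm {m : Measure Plane} {F : ℕ → Plane → ℝ}
    {f w : Plane → ℝ} (hF : ∀ n, MemLp (F n) 2 m) (hf : MemLp f 2 m) (hw : MemLp w 2 m)
    (h : Tendsto (fun n => eLpNorm (fun x => F n x - f x) 2 m) atTop (𝓝 0)) :
    Tendsto (fun n => ∫ x, F n x * w x ∂m) atTop (𝓝 (∫ x, f x * w x ∂m)) := by
  refine tendsto_integral_of_L1' _ (hf.integrable_mul hw).aestronglyMeasurable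
    (Eventually.of_forall fun n => (hF n).integrable_mul hw) ?_
  have hz : Tendsto (fun n => eLpNorm w 2 m * eLpNorm (fun x => F n x - f x) 2 m) atTop (𝓝 0) := by
    simpa using ENNReal.Tendsto.const_mul h (.inr hw.eLpNorm_ne_top)
  refine tendsto_of_tendsto_of_tendsto_of_le_of_le tendsto_const_nhds hz (fun _ => zero_le)
    fun n => ?_
  have := eLpNorm_smul_le_mul_eLpNorm (r := 1) (p := 2) (q := 2)
    ((hF n).sub hf).aestronglyMeasurable hw.aestronglyMeasurable
  refine le_trans (le_of_eq ?_) this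
  congr 1
  funext x
  simp only [Pi.sub_apply, Pi.smul_apply', Pi.mul_apply, smul_eq_mul]
  ring

/-- Green's formula for a function with trace `g`. -/
theorem IsTrace.integral_weakPartial_mul {v : L2Body} {g : Lp ℝ 2 arcLength} (h : IsTrace v g)
    {ψ : Plane → ℝ} (hψ : ContDiff ℝ ∞ ψ) (i : Fin 2) :
    ∫ x in body, weakPartial i v x * ψ x =
      (∫ x, normal x i * (g x * ψ x) ∂arcLength) - ∫ x in body, v x * partialD i ψ x := by
  obtain ⟨F, hF, ⟨-, h0, h1⟩, hb⟩ := h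
  have hF1 : ∀ n, ContDiff ℝ 1 (F n) := fun n => contDiff_infty.1 (hF n) 1
  have hψ1 : ContDiff ℝ 1 ψ := contDiff_infty.1 hψ 1
  have hB : ∀ {G : Plane → ℝ}, Continuous G → MemLp G 2 (volume.restrict body) := fun hG =>
    memLp_of_continuous ae_body_norm_le hG 2
  have t1 := tendsto_integral_mul_of_tendsto_eLpNorm
    (fun n => hB (continuous_partialD (hF1 n) i)) (Lp.memLp (weakPartial i v))
    (hB hψ.continuous) (h1 i)
  have t0 := tendsto_integral_mul_of_tendsto_eLpNorm
    (fun n => hB (hF1 n).continuous) (Lp.memLp v) (hB (continuous_partialD hψ1 i)) h0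
  have hA : MemLp (fun x => normal x i * ψ x) 2 arcLength :=
    (memLp_of_continuous ae_arcLength_norm_le hψ.continuous 2).mono
      ((measurable_normal i).mul hψ.continuous.measurable).aestronglyMeasurable
      (ae_of_all _ fun x => by
        rw [norm_mul]
        exact mul_le_of_le_one_left (norm_nonneg _) (norm_normal_le x i))
  have tb := tendsto_integral_mul_of_tendsto_eLpNorm
    (fun n => memLp_of_continuous ae_arcLength_norm_le (hF1 n).continuous 2) (Lp.memLp g) hA hb
  have e : ∀ n, (∫ x in body, partialD i (F n) x * ψ x) + (∫ x in body, F n x * partialD i ψ x) =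
      ∫ x, F n x * (normal x i * ψ x) ∂arcLength := by
    intro n
    have := integral_partialD_body ((hF1 n).mul hψ1) i
    simp_rw [partialD_mul (hF1 n) hψ1] at this
    have hadd := integral_add
      ((hB (continuous_partialD (hF1 n) i)).integrable_mul (hB hψ.continuous))
      ((hB (hF1 n).continuous).integrable_mul (hB (continuous_partialD hψ1 i)))
    simp only [Pi.mul_apply] at hadd
    refine hadd.symm.trans (this.trans (integral_congr_ae (ae_of_all _ fun x => ?_)))
    simp only; ring
  have := tendsto_nhds_unique (t1.add t0) (by simpa only [e] using tb)
  rw [eq_sub_iff_add_eq, this]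
  refine integral_congr_ae (ae_of_all _ fun x => ?_)
  simp only; ring

/-- The approximating test functions are supported in the open square, so they already vanish on the
boundary. -/
theorem MemH10.isTrace_zero {v : L2Body} (h : MemH10 v) : IsTrace v 0 := by
  obtain ⟨F, hF, hv⟩ := h
  refine ⟨F, fun n => (hF n).smooth, hv, ?_⟩
  have : ∀ n, eLpNorm (fun x => F n x - (0 : Lp ℝ 2 arcLength) x) 2 arcLength = 0 := by
    intro n
    have hz : ∀ᵐ x ∂arcLength, F n x = 0 := by
      refine ae_arcLength (measurableSet_eq_fun (hF n).smooth.continuous.measurable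
        measurable_const) fun i b hb s _ => ?_
      refine image_eq_zero_of_notMem_tsupport fun hx => ?_
      have := (side_mem_body.1 ((hF n).support hx)).2
      rcases hb with rfl | rfl
      · exact lt_irrefl _ this.1
      · exact lt_irrefl _ this.2
    rw [← eLpNorm_zero (p := 2) (μ := arcLength) (ε := ℝ)]
    refine eLpNorm_congr_ae ?_
    filter_upwards [hz, Lp.coeFn_zero ℝ 2 arcLength] with x h1 h2
    simp only [h1, h2, Pi.zero_apply, sub_zero]
  simp only [this, tendsto_const_nhds]

theorem MemH10.integral_weakPartial_mul {v : L2Body} (h : MemH10 v)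
    {ψ : Plane → ℝ} (hψ : ContDiff ℝ ∞ ψ) (i : Fin 2) :
    ∫ x in body, weakPartial i v x * ψ x = - ∫ x in body, v x * partialD i ψ x := by
  rw [h.isTrace_zero.integral_weakPartial_mul hψ]
  have : ∫ x, normal x i * ((0 : Lp ℝ 2 arcLength) x * ψ x) ∂arcLength = 0 := by
    rw [← integral_zero Plane ℝ (μ := arcLength)]
    refine integral_congr_ae ?_
    filter_upwards [Lp.coeFn_zero ℝ 2 arcLength] with x h2
    simp only [h2, Pi.zero_apply, zero_mul, mul_zero]
  rw [this, zero_sub]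

/-! ### Fourier coefficients against plane waves -/

/-- The plane wave with wave vector `ξ` and phase `θ`. -/
def wave (ξ : Plane) (θ : ℝ) (x : Plane) : ℝ := Real.cos (inner ℝ ξ x + θ)

theorem contDiff_wave (ξ : Plane) (θ : ℝ) : ContDiff ℝ ∞ (wave ξ θ) := by
  unfold wave
  exact Real.contDiff_cos.comp ((contDiff_const.inner ℝ contDiff_id).add contDiff_const)

theorem partialD_wave (i : Fin 2) (ξ : Plane) (θ : ℝ) (x : Plane) :
    partialD i (wave ξ θ) x = ξ i * wave ξ (θ + Real.pi / 2) x := by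
  have h := ((innerSL ℝ ξ).hasFDerivAt (x := x)).add_const θ |>.cos
  have e : fderiv ℝ (wave ξ θ) x = _ := h.fderiv
  unfold partialD
  rw [e, wave, ← add_assoc, Real.cos_add_pi_div_two]
  simp [EuclideanSpace.inner_single_right]
  ring

theorem wave_add_pi (ξ : Plane) (θ : ℝ) (x : Plane) : wave ξ (θ + Real.pi) x = -wave ξ θ x := by
  rw [wave, ← add_assoc, Real.cos_add_pi, wave]

/-- The Fourier coefficient of `v` at a plane wave. -/
def coeff (ξ : Plane) (θ : ℝ) (v : L2Body) : ℝ := ∫ x in body, v x * wave ξ θ x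

theorem coeff_add (ξ : Plane) (θ : ℝ) (v w : L2Body) :
    coeff ξ θ (v + w) = coeff ξ θ v + coeff ξ θ w :=
  integral_add_mul v w (contDiff_wave ξ θ).continuous

theorem coeff_smul (ξ : Plane) (θ c : ℝ) (v : L2Body) : coeff ξ θ (c • v) = c * coeff ξ θ v :=
  integral_smul_mul c v _

theorem coeff_add_pi (ξ : Plane) (θ : ℝ) (v : L2Body) :
    coeff ξ (θ + Real.pi) v = -coeff ξ θ v := by
  unfold coeff
  rw [← integral_neg]
  simp_rw [wave_add_pi, mul_neg]

theorem IsTrace.coeff_weakPartial {v : L2Body} {g : Lp ℝ 2 arcLength} (h : IsTrace v g)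
    (ξ : Plane) (θ : ℝ) (i : Fin 2) :
    coeff ξ θ (weakPartial i v) = (∫ x, normal x i * (g x * wave ξ θ x) ∂arcLength) -
      ξ i * coeff ξ (θ + Real.pi / 2) v := by
  unfold coeff
  rw [h.integral_weakPartial_mul (contDiff_wave ξ θ), ← integral_const_mul]
  simp_rw [partialD_wave]
  congr 2
  funext x; ring

/-- The zero trace removes the boundary term. Differentiating a wave shifts its phase by `π/2`, and
two shifts change its sign. -/
theorem MemH10.coeff_weakPartial {v : L2Body} (h : MemH10 v) (ξ : Plane) (θ : ℝ) (i : Fin 2) :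
    coeff ξ (θ + Real.pi / 2) (weakPartial i v) = ξ i * coeff ξ θ v := by
  have : coeff ξ θ v = - coeff ξ (θ + Real.pi / 2 + Real.pi / 2) v := by
    rw [add_assoc, add_halves, coeff_add_pi, neg_neg]
  rw [this]
  unfold coeff
  rw [h.integral_weakPartial_mul (contDiff_wave ξ _), mul_neg, ← integral_const_mul]
  simp_rw [partialD_wave]
  congr 2
  funext x; ring

theorem continuous_coeff_smul (ξ : Plane) (θ : ℝ) (v : L2Body) :
    Continuous fun r : ℝ => coeff (r • ξ) θ v := by
  have hv : Integrable v (volume.restrict body) := (Lp.memLp v).integrable (by norm_num)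
  unfold coeff
  refine continuous_of_dominated (bound := fun x => ‖v x‖) (fun r =>
    (integrable_mul_of_continuous v (contDiff_wave _ θ).continuous).aestronglyMeasurable)
    (fun r => ae_of_all _ fun x => ?_) hv.norm (ae_of_all _ fun x => ?_)
  · rw [norm_mul]
    exact mul_le_of_le_one_right (norm_nonneg _) (Real.abs_cos_le_one _)
  · unfold wave
    fun_prop

/-- Coefficients are continuous along rays, so it is enough to know that they vanish at wave vectors
accumulating at `ξ`. This is what allows the isolated zeros of the sine transform to be skipped. -/
theorem eq_zero_of_frequently_coeff_eq_zero {v : L2Body}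
    (h : ∀ ξ : Plane, ξ ≠ 0 → ∀ θ, ∃ᶠ r : ℝ in 𝓝[≠] 1, coeff (r • ξ) θ v = 0) : v = 0 := by
  have lim : ∀ (ξ : Plane) (θ r₀ : ℝ), (∃ᶠ r : ℝ in 𝓝[≠] r₀, coeff (r • ξ) θ v = 0) →
      coeff (r₀ • ξ) θ v = 0 := fun ξ θ r₀ hr =>
    isClosed_singleton.mem_of_frequently_of_tendsto hr
      ((continuous_coeff_smul ξ θ v).continuousAt.tendsto.mono_left nhdsWithin_le_nhds)
  have hne : ∀ ξ : Plane, ξ ≠ 0 → ∀ θ, coeff ξ θ v = 0 := fun ξ hξ θ => by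
    simpa using lim ξ θ 1 (h ξ hξ θ)
  have hall : ∀ (ξ : Plane) (θ : ℝ), coeff ξ θ v = 0 := by
    intro ξ θ
    by_cases hξ : ξ = 0
    -- The zero wave vector is reached as the limit `r → 0` along any ray.
    · obtain ⟨η, hη⟩ := exists_ne (0 : Plane)
      have := lim η θ 0 (Eventually.frequently ?_)
      · simpa [hξ] using this
      · filter_upwards [self_mem_nhdsWithin] with r hr using hne _ (smul_ne_zero hr hη) θ
    · exact hne ξ hξ θ
  refine (Lp.eq_zero_iff_ae_eq_zero).2 ?_
  exact ae_eq_zero_of_integral_mul_cos_eq_zero ((Lp.memLp v).integrable (by norm_num)) hall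

/-- Continuity and linearity on `L²` let the coefficient commute with time derivatives. -/
theorem exists_continuousLinearMap_eq_coeff (ξ : Plane) (θ : ℝ) :
    ∃ ℓ : L2Body →L[ℝ] ℝ, ∀ v, ℓ v = coeff ξ θ v := by
  have hw := memLp_of_continuous ae_body_norm_le (contDiff_wave ξ θ).continuous 2
  refine ⟨innerSL ℝ hw.toLp, fun v => ?_⟩
  rw [innerSL_apply_apply, L2.inner_def, coeff]
  refine integral_congr_ae ?_
  filter_upwards [hw.coeFn_toLp] with x hx
  rw [hx]; simp

/-! ### From the Lamé system to scalar oscillators -/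

/-- The symbol of the Lamé operator at the wave vector `ξ`, up to sign. -/
def lameSymbol (lam μ : ℝ) (ξ : Plane) (U : Fin 2 → ℝ) (j : Fin 2) : ℝ :=
  μ * (ξ 0 ^ 2 + ξ 1 ^ 2) * U j + (lam + μ) * ξ j * (ξ 0 * U 0 + ξ 1 * U 1)

theorem coeff_normalStress {v : Fin 2 → L2Body} (h0 : ∀ j, MemH10 (v j)) (lam μ : ℝ) (ξ : Plane)
    (θ : ℝ) (j : Fin 2) :
    coeff ξ (θ + Real.pi / 2) (normalStress lam μ v j) =
      lam * (ξ 0 * coeff ξ θ (v 0) + ξ 1 * coeff ξ θ (v 1)) + 2 * μ * (ξ j * coeff ξ θ (v j)) := by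
  rw [normalStress, divergence, Fin.sum_univ_two, coeff_add, coeff_smul, coeff_smul, coeff_add,
    (h0 0).coeff_weakPartial, (h0 1).coeff_weakPartial, (h0 j).coeff_weakPartial]

theorem coeff_shearStress {v : Fin 2 → L2Body} (h0 : ∀ j, MemH10 (v j)) (μ : ℝ) (ξ : Plane)
    (θ : ℝ) :
    coeff ξ (θ + Real.pi / 2) (shearStress μ v) =
      μ * (ξ 1 * coeff ξ θ (v 0) + ξ 0 * coeff ξ θ (v 1)) := by
  rw [shearStress, coeff_smul, coeff_add, (h0 0).coeff_weakPartial, (h0 1).coeff_weakPartial]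

theorem integral_traction_mul {g k : Lp ℝ 2 arcLength} {X : Plane → ℝ} {i j : Fin 2}
    (h : ∀ᵐ x ∂arcLength, normal x i * g x + normal x j * k x = X x) {w : Plane → ℝ}
    (hw : Continuous w) :
    (∫ x, normal x i * (g x * w x) ∂arcLength) + ∫ x, normal x j * (k x * w x) ∂arcLength =
      ∫ x, X x * w x ∂arcLength := by
  have hi : ∀ (g : Lp ℝ 2 arcLength) (i : Fin 2),
      Integrable (fun x => normal x i * (g x * w x)) arcLength := fun g i =>
    integrable_normal_mul ((Lp.memLp g).integrable_mul
      (memLp_of_continuous ae_arcLength_norm_le hw 2)) i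
  rw [← integral_add (hi g i) (hi k j)]
  refine integral_congr_ae ?_
  filter_upwards [h] with x hx
  rw [← hx]; ring

/-- Betti's formula for clamped fields, tested with plane waves. -/
theorem coeff_lameOperator {v : Fin 2 → L2Body} (h0 : ∀ j, MemH10 (v j)) (h2 : ∀ j, MemH2 (v j))
    {lam μ : ℝ} {σ₁ σ₂ τ : Lp ℝ 2 arcLength} (hσ₁ : IsTrace (normalStress lam μ v 0) σ₁)
    (hσ₂ : IsTrace (normalStress lam μ v 1) σ₂) (hτ : IsTrace (shearStress μ v) τ)
    {X : Fin 2 → Plane → ℝ}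
    (hX₀ : ∀ᵐ x ∂arcLength, normal x 0 * σ₁ x + normal x 1 * τ x = X 0 x)
    (hX₁ : ∀ᵐ x ∂arcLength, normal x 1 * σ₂ x + normal x 0 * τ x = X 1 x)
    (ξ : Plane) (θ : ℝ) (j : Fin 2) :
    coeff ξ θ (lameOperator lam μ v j) =
      (∫ x, X j x * wave ξ θ x ∂arcLength) -
        lameSymbol lam μ ξ (fun l => coeff ξ θ (v l)) j := by
  have hw := (contDiff_wave ξ θ).continuous
  have e0 : coeff ξ θ (lameOperator lam μ v 0) = (∫ x, X 0 x * wave ξ θ x ∂arcLength) -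
      lameSymbol lam μ ξ (fun l => coeff ξ θ (v l)) 0 := by
    rw [lameOperator_zero h2, coeff_add, hσ₁.coeff_weakPartial, hτ.coeff_weakPartial,
      ← integral_traction_mul hX₀ hw, coeff_normalStress h0, coeff_shearStress h0, lameSymbol]
    ring
  have e1 : coeff ξ θ (lameOperator lam μ v 1) = (∫ x, X 1 x * wave ξ θ x ∂arcLength) -
      lameSymbol lam μ ξ (fun l => coeff ξ θ (v l)) 1 := by
    rw [lameOperator_one h2, coeff_add, hσ₂.coeff_weakPartial, hτ.coeff_weakPartial,
      ← integral_traction_mul hX₁ hw, coeff_normalStress h0, coeff_shearStress h0, lameSymbol]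
    ring
  fin_cases j
  · exact e0
  · exact e1

theorem IsSolution.coeff_iteratedDerivWithin {T lam μ : ℝ} {I : SystemData T}
    {u : Fin 2 → ℝ → L2Body} {f : Fin 2 → L2Body} (hu : MemSolutionSpace T u)
    (h : IsSolution T lam μ I u f) (ξ : Plane) (θ : ℝ) :
    ∀ᵐ t ∂(volume.restrict (Ioo 0 T)), ∀ j,
      coeff ξ θ (iteratedDerivWithin 2 (u j) (Icc 0 T) t) =
        (∫ x, I.X j t x * wave ξ θ x ∂arcLength) -
          lameSymbol lam μ ξ (fun l => coeff ξ θ (u l t)) j + I.φ t * coeff ξ θ (f j) := by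
  filter_upwards [h.lame, h.clamped, h.surface, (hu 0).2.memH2, (hu 1).2.memH2]
    with t hl h0 ⟨σ₁, σ₂, τ, hσ₁, hσ₂, hτ, hX₀, hX₁⟩ m0 m1 j
  have h2 : ∀ j, MemH2 (u j t) := by
    intro j
    fin_cases j
    · exact m0
    · exact m1
  rw [hl j, coeff_add, coeff_smul]
  have := coeff_lameOperator h0 h2 hσ₁ hσ₂ hτ (X := fun j => I.X j t) hX₀ hX₁ ξ θ j
  rw [lameOperator] at this
  rw [this]

/-- Along an eigenvector `a` of the Lamé symbol, the Fourier coefficient of the difference of two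
solutions is a forced harmonic oscillator at rest at time `0`. -/
theorem IsSolution.duhamel_coeff {T lam μ : ℝ} (hT : 0 < T) {I : SystemData T}
    {u u' : Fin 2 → ℝ → L2Body} {f f' : Fin 2 → L2Body}
    (hu : MemSolutionSpace T u) (hu' : MemSolutionSpace T u')
    (h : IsSolution T lam μ I u f) (h' : IsSolution T lam μ I u' f') {ξ : Plane} (θ : ℝ)
    {a : Fin 2 → ℝ} {k : ℝ}
    (hk : ∀ U, a 0 * lameSymbol lam μ ξ U 0 + a 1 * lameSymbol lam μ ξ U 1 =
      k ^ 2 * (a 0 * U 0 + a 1 * U 1)) {s : ℝ} (hs : s ∈ Icc 0 T) :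
    k * (a 0 * coeff ξ θ (u 0 s - u' 0 s) + a 1 * coeff ξ θ (u 1 s - u' 1 s)) =
      (a 0 * coeff ξ θ (f 0 - f' 0) + a 1 * coeff ξ θ (f 1 - f' 1)) *
        ∫ t in Ioo 0 s, Real.sin (k * (s - t)) * I.φ t := by
  obtain ⟨ℓ, hℓ⟩ := exists_continuousLinearMap_eq_coeff ξ θ
  have hI := uniqueDiffOn_Icc hT
  have m0 : (0 : ℝ) ∈ Icc 0 T := ⟨le_rfl, hT.le⟩
  set Z : ℝ → L2Body := a 0 • (u 0 - u' 0) + a 1 • (u 1 - u' 1) with hZ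
  have hW : ∀ j, ContDiffOn ℝ 2 (u j - u' j) (Icc 0 T) := fun j => (hu j).1.sub (hu' j).1
  have hZc : ContDiffOn ℝ 2 Z (Icc 0 T) := ((hW 0).const_smul (a 0)).add ((hW 1).const_smul (a 1))
  have hu0 : ∀ j, u j 0 = u' j 0 := fun j => Lp.ext ((h.initial j).trans (h'.initial j).symm)
  have hd0 : ∀ j, derivWithin (u j) (Icc 0 T) 0 = derivWithin (u' j) (Icc 0 T) 0 := fun j =>
    Lp.ext ((h.velocity j).trans (h'.velocity j).symm)
  have hWd : ∀ j, HasDerivWithinAt (u j - u' j) 0 (Icc 0 T) 0 := by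
    intro j
    have := (((hu j).1.differentiableOn (by norm_num) 0 m0).hasDerivWithinAt).sub
      ((hu' j).1.differentiableOn (by norm_num) 0 m0).hasDerivWithinAt
    rwa [hd0, sub_self] at this
  have hZd : HasDerivWithinAt Z 0 (Icc 0 T) 0 := by
    simpa using ((hWd 0).const_smul (a 0)).add ((hWd 1).const_smul (a 1))
  have hY1 : HasDerivWithinAt (ℓ ∘ Z) 0 (Icc 0 T) 0 := by
    simpa using ℓ.hasFDerivAt.comp_hasDerivWithinAt 0 hZd
  have hY0 : (ℓ ∘ Z) 0 = 0 := by simp [hZ, hu0]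
  have hode : ∀ᵐ t ∂(volume.restrict (Ioo 0 T)),
      iteratedDerivWithin 2 (ℓ ∘ Z) (Icc 0 T) t = -(k ^ 2 * (ℓ ∘ Z) t) +
        I.φ t * (a 0 * coeff ξ θ (f 0 - f' 0) + a 1 * coeff ξ θ (f 1 - f' 1)) := by
    filter_upwards [h.coeff_iteratedDerivWithin hu ξ θ, h'.coeff_iteratedDerivWithin hu' ξ θ,
      ae_restrict_mem measurableSet_Ioo] with t e e' ht
    have mt := Ioo_subset_Icc_self ht
    have hWt : ∀ j, iteratedDerivWithin 2 (u j - u' j) (Icc 0 T) t =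
        iteratedDerivWithin 2 (u j) (Icc 0 T) t - iteratedDerivWithin 2 (u' j) (Icc 0 T) t :=
      fun j => iteratedDerivWithin_sub mt hI ((hu j).1 t mt) ((hu' j).1 t mt)
    have hZt : iteratedDerivWithin 2 Z (Icc 0 T) t =
        a 0 • (iteratedDerivWithin 2 (u 0) (Icc 0 T) t - iteratedDerivWithin 2 (u' 0) (Icc 0 T) t)
        + a 1 • (iteratedDerivWithin 2 (u 1) (Icc 0 T) t -
          iteratedDerivWithin 2 (u' 1) (Icc 0 T) t) := by
      have hc : ∀ j, ContDiffWithinAt ℝ 2 (a j • (u j - u' j)) (Icc 0 T) t := fun j =>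
        (hW j).const_smul (a j) t mt
      rw [hZ, iteratedDerivWithin_add mt hI (hc 0) (hc 1),
        iteratedDerivWithin_const_smul mt hI _ (hW 0 t mt),
        iteratedDerivWithin_const_smul mt hI _ (hW 1 t mt), hWt, hWt]
    have hcomp : iteratedDerivWithin 2 (ℓ ∘ Z) (Icc 0 T) t =
        ℓ (iteratedDerivWithin 2 Z (Icc 0 T) t) := by
      simp only [iteratedDerivWithin]
      rw [ℓ.iteratedFDerivWithin_comp_left (hZc t mt) hI mt le_rfl]
      rfl
    have hk' := hk fun l => coeff ξ θ (u l t)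
    have hk'' := hk fun l => coeff ξ θ (u' l t)
    have hf : ∀ j, coeff ξ θ (f j - f' j) = coeff ξ θ (f j) - coeff ξ θ (f' j) := fun j => by
      rw [← hℓ, map_sub, hℓ, hℓ]
    rw [hcomp, hZt, hf, hf]
    simp only [hZ, Function.comp_apply, Pi.add_apply, Pi.smul_apply, Pi.sub_apply, map_add,
      map_smul, map_sub, smul_eq_mul]
    simp only [hℓ, e, e']
    -- The boundary integrals against `X` cancel here, being the same for both solutions.
    linear_combination hk'' - hk'
  have := duhamel hT (ℓ.contDiff.comp_contDiffOn hZc) hY0 (hY1.derivWithin (hI 0 m0)) hode hs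
  rw [← this, ← hℓ, ← hℓ]
  simp [hZ]

/-! ### Longitudinal and transverse waves, and uniqueness -/

/-- The Lamé symbol acts by `(λ + 2μ) |ξ|²` along `ξ` and by `μ |ξ|²` across it. -/
theorem longitudinal_lameSymbol {lam μ : ℝ} (hlam : 0 ≤ lam + 2 * μ) (ξ : Plane) (U : Fin 2 → ℝ) :
    ξ 0 * lameSymbol lam μ ξ U 0 + ξ 1 * lameSymbol lam μ ξ U 1 =
      (√(lam + 2 * μ) * ‖ξ‖) ^ 2 * (ξ 0 * U 0 + ξ 1 * U 1) := by
  rw [mul_pow, Real.sq_sqrt hlam, EuclideanSpace.real_norm_sq_eq, Fin.sum_univ_two]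
  unfold lameSymbol
  ring

theorem transverse_lameSymbol (lam : ℝ) {μ : ℝ} (hμ : 0 ≤ μ) (ξ : Plane) (U : Fin 2 → ℝ) :
    -ξ 1 * lameSymbol lam μ ξ U 0 + ξ 0 * lameSymbol lam μ ξ U 1 =
      (√μ * ‖ξ‖) ^ 2 * (-ξ 1 * U 0 + ξ 0 * U 1) := by
  rw [mul_pow, Real.sq_sqrt hμ, EuclideanSpace.real_norm_sq_eq, Fin.sum_univ_two]
  unfold lameSymbol
  ring

theorem eq_zero_of_longitudinal_of_transverse {ξ : Plane} (hξ : ξ ≠ 0) {U : Fin 2 → ℝ}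
    (hl : ξ 0 * U 0 + ξ 1 * U 1 = 0) (ht : -ξ 1 * U 0 + ξ 0 * U 1 = 0) (j : Fin 2) : U j = 0 := by
  have hn : ξ 0 ^ 2 + ξ 1 ^ 2 ≠ 0 := by
    have := EuclideanSpace.real_norm_sq_eq ξ
    rw [Fin.sum_univ_two] at this
    rw [← this]
    exact pow_ne_zero 2 (norm_ne_zero_iff.2 hξ)
  have h0 : U 0 = 0 := (mul_eq_zero.1 (by linear_combination ξ 0 * hl - ξ 1 * ht :
    (ξ 0 ^ 2 + ξ 1 ^ 2) * U 0 = 0)).resolve_left hn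
  have h1 : U 1 = 0 := (mul_eq_zero.1 (by linear_combination ξ 1 * hl + ξ 0 * ht :
    (ξ 0 ^ 2 + ξ 1 ^ 2) * U 1 = 0)).resolve_left hn
  fin_cases j
  · exact h0
  · exact h1

theorem IsSolution.source_unique {T lam μ : ℝ} (hT : 0 < T) (hμ : 0 < μ) (hlam : 0 < lam + 2 * μ)
    {I : SystemData T} (hφ : I.φ ≠ 0) {u u' : Fin 2 → ℝ → L2Body} {f f' : Fin 2 → L2Body}
    (hu : MemSolutionSpace T u) (hu' : MemSolutionSpace T u')
    (h : IsSolution T lam μ I u f) (h' : IsSolution T lam μ I u' f') (j : Fin 2) :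
    f j - f' j = 0 := by
  have hφi : IntegrableOn I.φ (Ioo 0 T) := L1.integrable_coeFn I.φ
  have hφ0 : ¬ I.φ =ᵐ[volume.restrict (Ioo 0 T)] 0 := fun h0 =>
    hφ (Lp.eq_zero_iff_ae_eq_zero.2 h0)
  have hD := eventually_integral_sin_mul_ne_zero hφi hφ0
  have mT : T ∈ Icc 0 T := ⟨hT.le, le_rfl⟩
  have huT : ∀ j, u j T - u' j T = 0 := fun j =>
    sub_eq_zero.2 (Lp.ext ((h.final j).trans (h'.final j).symm))
  have hc0 : ∀ (ξ : Plane) (θ : ℝ), coeff ξ θ 0 = 0 := fun ξ θ => by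
    simpa using coeff_smul ξ θ 0 0
  -- Isolation of zeros in the frequency becomes isolation in the scaling `r` of the wave vector.
  -- Both wave speeds are then treated at the same `r`.
  have hray : ∀ c : ℝ, 0 < c → ∀ᶠ r : ℝ in 𝓝[≠] 1,
      ∫ t in Ioo 0 T, Real.sin ((c * r) * (T - t)) * I.φ t ≠ 0 := by
    intro c hc
    have ht : Tendsto (fun r : ℝ => c * r) (𝓝[≠] 1) (𝓝[≠] (c * 1)) := by
      refine tendsto_nhdsWithin_of_tendsto_nhds_of_eventually_within _
        (((continuous_const_mul c).tendsto 1).mono_left nhdsWithin_le_nhds) ?_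
      filter_upwards [self_mem_nhdsWithin] with r hr
      simpa [hc.ne'] using hr
    exact ht.eventually (hD (c * 1))
  refine eq_zero_of_frequently_coeff_eq_zero fun ξ hξ θ => Eventually.frequently ?_
  have hn : 0 < ‖ξ‖ := norm_pos_iff.2 hξ
  have hpos : ∀ᶠ r : ℝ in 𝓝[≠] 1, 0 < r := nhdsWithin_le_nhds (lt_mem_nhds one_pos)
  filter_upwards [hray (√(lam + 2 * μ) * ‖ξ‖) (by positivity), hray (√μ * ‖ξ‖) (by positivity),
    hpos] with r hl ht hr
  have hnorm : ∀ c : ℝ, c * ‖ξ‖ * r = c * ‖r • ξ‖ := fun c => by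
    rw [norm_smul, Real.norm_of_nonneg hr.le]; ring
  rw [hnorm] at hl ht
  have el := h.duhamel_coeff hT hu hu' h' θ (a := fun i => (r • ξ) i)
    (longitudinal_lameSymbol hlam.le (r • ξ)) mT
  have et := h.duhamel_coeff hT hu hu' h' θ (a := ![-(r • ξ) 1, (r • ξ) 0])
    (transverse_lameSymbol lam hμ.le (r • ξ)) mT
  -- The common final displacement turns Duhamel's formula into `0 = G` times a nonzero integral.
  rw [huT, huT, hc0, mul_zero, mul_zero, add_zero, mul_zero] at el et
  exact eq_zero_of_longitudinal_of_transverse (smul_ne_zero hr.ne' hξ)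
    (U := fun j => coeff (r • ξ) θ (f j - f' j))
    ((mul_eq_zero.1 el.symm).resolve_right hl) ((mul_eq_zero.1 et.symm).resolve_right ht) j

theorem IsSolution.displacement_unique {T lam μ : ℝ} (hT : 0 < T) (hμ : 0 < μ)
    (hlam : 0 < lam + 2 * μ) {I : SystemData T} {u u' : Fin 2 → ℝ → L2Body} {f : Fin 2 → L2Body}
    (hu : MemSolutionSpace T u) (hu' : MemSolutionSpace T u')
    (h : IsSolution T lam μ I u f) (h' : IsSolution T lam μ I u' f) (j : Fin 2) {s : ℝ}
    (hs : s ∈ Icc 0 T) : u j s = u' j s := by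
  have hc0 : ∀ (ξ : Plane) (θ : ℝ), coeff ξ θ 0 = 0 := fun ξ θ => by
    simpa using coeff_smul ξ θ 0 0
  have hne : ∀ ξ : Plane, ξ ≠ 0 → ∀ θ, coeff ξ θ (u j s - u' j s) = 0 := by
    intro ξ hξ θ
    have hn : 0 < ‖ξ‖ := norm_pos_iff.2 hξ
    have el := h.duhamel_coeff hT hu hu' h' θ (a := fun i => ξ i)
      (longitudinal_lameSymbol hlam.le ξ) hs
    have et := h.duhamel_coeff hT hu hu' h' θ (a := ![-ξ 1, ξ 0])
      (transverse_lameSymbol lam hμ.le ξ) hs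
    rw [sub_self, sub_self, hc0, mul_zero, mul_zero, add_zero, zero_mul] at el et
    exact eq_zero_of_longitudinal_of_transverse hξ (U := fun j => coeff ξ θ (u j s - u' j s))
      ((mul_eq_zero.1 el).resolve_left (by positivity))
      ((mul_eq_zero.1 et).resolve_left (by positivity)) j
  refine sub_eq_zero.1 (eq_zero_of_frequently_coeff_eq_zero fun ξ hξ θ =>
    Eventually.frequently ?_)
  filter_upwards [nhdsWithin_le_nhds (lt_mem_nhds one_pos)] with r hr
  exact hne _ (smul_ne_zero hr.ne' hξ) θ

end

end LameSource

theorem theorem1 (T : ℝ) (hT : 0 < T) (lam μ : ℝ) (hμ : 0 < μ) (hlam : 0 < lam + 2 * μ)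
    (I : LameSource.SystemData T) (hφ : I.φ ≠ 0)
    (u u' : Fin 2 → ℝ → LameSource.L2Body) (f f' : Fin 2 → LameSource.L2Body)
    (hu : LameSource.MemSolutionSpace T u) (hu' : LameSource.MemSolutionSpace T u')
    (h : LameSource.IsSolution T lam μ I u f) (h' : LameSource.IsSolution T lam μ I u' f') :
    (∀ j, ∀ t ∈ Set.Icc 0 T, u j t = u' j t) ∧ f = f' := by
  have hf : f = f' := funext fun j =>
    sub_eq_zero.1 (h.source_unique hT hμ hlam hφ hu hu' h' j)
  subst hf
  exact ⟨fun j t ht => h.displacement_unique hT hμ hlam hu hu' h' j ht, rfl⟩
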